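/- All rings are commutative with identity. Let $R$ be a Noetherian ring and let $M$ be a finitely generated $R$-module. For an ideal $I$ of $R$, let $H^i_I(N)=\varinjlim_n\operatorname{Ext}^i_R(R/I^n,N)$ denote the $i$-th local cohomology module of an $R$-module $N$. For a finite sequence ${\bf x}=x_1,\ldots,x_\ell$ in $R$ and $n\ge 0$ put ${\bf x}^n=x_1^n,\ldots,x_\ell^n$. Let $\mathbb K_\bullet({\bf x};M)=\mathbb K_\bullet(x_1)\otimes_R\cdots\otimes_R\mathbb K_\bullet(x_\ell)\otimes_R M$ be the Koszul complex, where $\mathbb K_\bullet(x)$ is the complex $0\to R\xrightarrow{\,x\,}R\to 0$ in degrees $1,0$, and let $H_i({\bf x};M)$ be its $i$-th homology. For $m\ge n$ let $\phi^m_n:\mathbb K_\bullet({\bf x}^m;M)\to\mathbb K_\bullet({\bf x}^n;M)$ be the tensor product of the identity of $M$ with the chain maps $\mathbb K_\bullet(x_j^m)\to\mathbb K_\bullet(x_j^n)$ ($1\le j\le\ell$) that are the identity in degree $0$ and multiplication by $x_j^{m-n}$ in degree $1$. The sequence ${\bf x}$ is called $M$-weakly proregular if for each $n$ there is an $m\ge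 n$ such that the map $H_i({\bf x}^m;M)\to H_i({\bf x}^n;M)$ induced by $\phi^m_n$ is zero for all $i\ge1$. Then: 1. $H^i_I(\operatorname{Hom}_R(M,E))=0$ for every ideal $I$ of $R$, every injective $R$-module $E$ and every $i\ne0$; 2. every finite sequence of elements of $R$ is $M$-weakly proregular. -/

import Mathlib

open CategoryTheory

universe v u

noncomputable section

namespace Koszul

variable {R : Type u} [CommRing R]

/-- The degree `n` part of `K(x) ⊗ L`, where `K(x)` is the complex `0 → R → R → 0` in degrees
`1, 0`: this is `(R e₀ ⊗ Lₙ) ⊕ (R e₁ ⊗ Lₙ₋₁) = Lₙ ⊕ Lₙ₋₁`, and `(a, b)` stands for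
`e₀ ⊗ a + e₁ ⊗ b`. -/
def tensorX (L : ChainComplex (ModuleCat.{v} R) ℕ) : ℕ → ModuleCat.{v} R
  | 0 => L.X 0
  | n + 1 => ModuleCat.of R (L.X (n + 1) × L.X n)

/-- The differential of `K(x) ⊗ L`. As the differential of `K(x)` sends `e₁` to `x e₀`, it is
`d (e₀ ⊗ a + e₁ ⊗ b) = e₀ ⊗ (d a + x b) - e₁ ⊗ d b`. -/
def tensorD (x : R) (L : ChainComplex (ModuleCat.{v} R) ℕ) :
    ∀ n : ℕ, tensorX L (n + 1) ⟶ tensorX L n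
  | 0 => ModuleCat.ofHom (LinearMap.coprod (L.d 1 0).hom (x • LinearMap.id))
  | n + 1 => ModuleCat.ofHom
      (LinearMap.prod
        (LinearMap.coprod (L.d (n + 2) (n + 1)).hom (x • LinearMap.id))
        (-((L.d (n + 1) n).hom ∘ₗ LinearMap.snd R (L.X (n + 2)) (L.X (n + 1)))))

lemma d_d_apply (L : ChainComplex (ModuleCat.{v} R) ℕ) (i j k : ℕ) (a : L.X i) :
    (L.d j k).hom ((L.d i j).hom a) = 0 := by
  rw [← LinearMap.comp_apply, ← ModuleCat.hom_comp, L.d_comp_d]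
  rfl

lemma tensorD_comp_tensorD (x : R) (L : ChainComplex (ModuleCat.{v} R) ℕ) (n : ℕ) :
    tensorD x L (n + 1) ≫ tensorD x L n = 0 := by
  cases n with
  | zero =>
    ext ⟨a, b⟩
    change (L.d 1 0).hom ((L.d 2 1).hom a + x • b) + x • (-((L.d 1 0).hom b)) = 0
    simp [d_d_apply]
  | succ n =>
    ext ⟨a, b⟩
    change ((L.d (n + 2) (n + 1)).hom ((L.d (n + 3) (n + 2)).hom a + x • b)
        + x • (-((L.d (n + 2) (n + 1)).hom b)),
      -((L.d (n + 1) n).hom (-((L.d (n + 2) (n + 1)).hom b)))) = 0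
    simp [d_d_apply]

/-- The tensor product `K(x) ⊗ L` of the complex `K(x) : 0 → R → R → 0` (multiplication by `x`,
in degrees `1, 0`) with a chain complex `L`. -/
def tensor (x : R) (L : ChainComplex (ModuleCat.{v} R) ℕ) : ChainComplex (ModuleCat.{v} R) ℕ :=
  ChainComplex.of (tensorX L) (tensorD x L) (tensorD_comp_tensorD x L)

lemma tensor_d (x : R) (L : ChainComplex (ModuleCat.{v} R) ℕ) (n : ℕ) :
    (tensor x L).d (n + 1) n = tensorD x L n :=
  ChainComplex.of_d _ _ _

/-- The degree `n` part of `φ ⊗ f`, where `φ : K(x) → K(x')` is the identity in degree `0` and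
multiplication by `y` in degree `1`: it sends `e₀ ⊗ a + e₁ ⊗ b` to `e₀ ⊗ f a + e₁ ⊗ y f b`. -/
def tensorMapX (y : R) {L L' : ChainComplex (ModuleCat.{v} R) ℕ} (f : L ⟶ L') :
    ∀ n : ℕ, tensorX L n ⟶ tensorX L' n
  | 0 => f.f 0
  | n + 1 => ModuleCat.ofHom (LinearMap.prodMap (f.f (n + 1)).hom (y • (f.f n).hom))

lemma comm_apply {L L' : ChainComplex (ModuleCat.{v} R) ℕ} (f : L ⟶ L') (i j : ℕ) (a : L.X i) :
    (L'.d i j).hom ((f.f i).hom a) = (f.f j).hom ((L.d i j).hom a) := by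
  rw [← LinearMap.comp_apply, ← LinearMap.comp_apply, ← ModuleCat.hom_comp, ← ModuleCat.hom_comp,
    f.comm]

lemma tensorMapX_comm {x x' y : R} (h : x = x' * y) {L L' : ChainComplex (ModuleCat.{v} R) ℕ}
    (f : L ⟶ L') (n : ℕ) :
    tensorMapX y f (n + 1) ≫ tensorD x' L' n = tensorD x L n ≫ tensorMapX y f n := by
  subst h
  cases n with
  | zero =>
    ext ⟨a, b⟩
    change (L'.d 1 0).hom ((f.f 1).hom a) + x' • (y • (f.f 0).hom b) =
      (f.f 0).hom ((L.d 1 0).hom a + (x' * y) • b)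
    simp [comm_apply, mul_smul]
  | succ n =>
    ext ⟨a, b⟩
    change ((L'.d (n + 2) (n + 1)).hom ((f.f (n + 2)).hom a) + x' • (y • (f.f (n + 1)).hom b),
        -((L'.d (n + 1) n).hom (y • (f.f (n + 1)).hom b))) =
      ((f.f (n + 1)).hom ((L.d (n + 2) (n + 1)).hom a + (x' * y) • b),
        y • (f.f n).hom (-((L.d (n + 1) n).hom b)))
    simp [comm_apply, mul_smul]

/-- The chain map `φ ⊗ f : K(x) ⊗ L → K(x') ⊗ L'`, where `x = x' y` and `φ : K(x) → K(x')` is the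
identity in degree `0` and multiplication by `y` in degree `1`. -/
def tensorMap {x x' y : R} (h : x = x' * y) {L L' : ChainComplex (ModuleCat.{v} R) ℕ}
    (f : L ⟶ L') : tensor x L ⟶ tensor x' L' :=
  ChainComplex.ofHom (tensorMapX y f) fun n => by
    rw [tensor_d x' L' n, tensor_d x L n]
    exact tensorMapX_comm h f n

/-- The Koszul complex `K(x₁, …, x_ℓ; M) = K(x₁) ⊗ ⋯ ⊗ K(x_ℓ) ⊗ M`, with `M` in degree `0`. -/
def complex (M : ModuleCat.{v} R) : List R → ChainComplex (ModuleCat.{v} R) ℕ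
  | [] => (ChainComplex.single₀ (ModuleCat.{v} R)).obj M
  | x :: xs => tensor x (complex M xs)

/-- The chain map `φₙᵐ : K(x₁ᵐ, …, x_ℓᵐ; M) → K(x₁ⁿ, …, x_ℓⁿ; M)` for `n ≤ m`, the tensor product
of the maps `K(x_jᵐ) → K(x_jⁿ)` that are the identity in degree `0` and multiplication by
`x_jᵐ⁻ⁿ` in degree `1`. -/
def transition (M : ModuleCat.{v} R) {n m : ℕ} (h : n ≤ m) :
    ∀ xs : List R, complex M (xs.map (· ^ m)) ⟶ complex M (xs.map (· ^ n))
  | [] => 𝟙 _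
  | x :: xs => tensorMap (pow_mul_pow_sub x h).symm (transition M h xs)

end Koszul

/-- A finite sequence `xs` of elements of `R` is `M`-weakly proregular if for each `n` there is
`m ≥ n` such that `φₙᵐ` induces the zero map on Koszul homology `Hᵢ(xsᵐ; M) → Hᵢ(xsⁿ; M)` for all
`i ≥ 1`. -/
def IsWeaklyProregular {R : Type u} [CommRing R] (xs : List R)
    (M : Type v) [AddCommGroup M] [Module R M] : Prop :=
  ∀ n : ℕ, ∃ m : ℕ, ∃ h : n ≤ m, ∀ i : ℕ, 1 ≤ i →
    HomologicalComplex.homologyMap (Koszul.transition (ModuleCat.of R M) h xs) i = 0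

end

/-!
Both parts assert that an inverse system of (co)homology modules has eventually vanishing maps.

*Local cohomology.* Choose `0 → K → F → M → 0` with `F` finite free. Since `Hom(F, E)` is injective,
dimension shifting along `0 → Hom(M, E) → Hom(F, E) → Hom(K, E) → 0` reduces the vanishing of
`Extⁱ(R/Iⁿ, Hom(M, E)) → Extⁱ(R/Iᵐ, Hom(M, E))` to `i = 1`. There it says that every map `K → E`
killed by `Iⁿ` extends to a map `F → E` killed by `Iᵐ`, which follows from the Artin–Rees inclusion
`K ∩ Iⁿ⁺ᶜF ⊆ IⁿK` and the injectivity of `E`.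

*Koszul homology.* `Hᵢ(K(x) ⊗ L)` is an extension of the `x`-torsion of `Hᵢ₋₁(L)` by
`Hᵢ(L)/x Hᵢ(L)`. Of two consecutive transition maps the first kills the torsion quotient and the
second the remaining submodule. Only the `x`-torsion of `H₀(L)` needs more than induction on the
length of the sequence: it is killed because the ascending chain `(0 : xᵏ)` in a Noetherian module
stabilizes.
-/

universe w

section Homology

lemma homologyMap_eq_zero_iff_shortComplexFunctor' {C : Type*} [Category* C]
    [Limits.HasZeroMorphisms C] [CategoryWithHomology C] {ι : Type*} {c : ComplexShape ι}
    {K L : HomologicalComplex C c} (f : K ⟶ L) {i j k : ι} (hi : c.prev j = i)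
    (hk : c.next j = k) :
    HomologicalComplex.homologyMap f j = 0 ↔ ShortComplex.homologyMap
      ((HomologicalComplex.shortComplexFunctor' C c i j k).map f) = 0 := by
  subst hi hk
  rfl

variable {R : Type u} [Ring R]

lemma shortComplex_homologyMap_eq_zero_iff {S S' : ShortComplex (ModuleCat.{v} R)} (φ : S ⟶ S') :
    ShortComplex.homologyMap φ = 0 ↔
      ∀ z : S.X₂, S.g z = 0 → ∃ w : S'.X₁, S'.f w = φ.τ₂ z := by
  have exact_cycles : (ShortComplex.mk S.iCycles S.g S.iCycles_g).Exact :=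
    ShortComplex.exact_of_f_is_kernel _ S.cyclesIsKernel
  have exact_homology :
      (ShortComplex.mk S'.toCycles S'.homologyπ S'.toCycles_comp_homologyπ).Exact :=
    ShortComplex.exact_of_g_is_cokernel _ S'.homologyIsCokernel
  rw [ShortComplex.moduleCat_exact_iff] at exact_cycles exact_homology
  have iCycles_injective := (ModuleCat.mono_iff_injective S'.iCycles).1 inferInstance
  have iCycles_cyclesMap (c : S.cycles) :
      S'.iCycles (ShortComplex.cyclesMap φ c) = φ.τ₂ (S.iCycles c) :=
    ConcreteCategory.congr_hom (ShortComplex.cyclesMap_i φ) c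
  have iCycles_toCycles (w : S'.X₁) : S'.iCycles (S'.toCycles w) = S'.f w :=
    ConcreteCategory.congr_hom S'.toCycles_i w
  rw [← cancel_epi S.homologyπ, ShortComplex.homologyπ_naturality, Limits.comp_zero]
  refine ⟨fun h z hz => ?_, fun h => ?_⟩
  · obtain ⟨c, rfl⟩ := exact_cycles z hz
    obtain ⟨w, hw⟩ := exact_homology _ (ConcreteCategory.congr_hom h c)
    exact ⟨w, by rw [← iCycles_toCycles, ← iCycles_cyclesMap]; exact congrArg _ hw⟩
  · ext c
    obtain ⟨w, hw⟩ := h (S.iCycles c) (ConcreteCategory.congr_hom S.iCycles_g c)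
    have hc : ShortComplex.cyclesMap φ c = S'.toCycles w :=
      iCycles_injective (by rw [iCycles_cyclesMap, iCycles_toCycles, hw])
    change S'.homologyπ (ShortComplex.cyclesMap φ c) = 0
    rw [hc]
    exact ConcreteCategory.congr_hom S'.toCycles_comp_homologyπ w

lemma chainComplex_homologyMap_succ_eq_zero_iff {L L' : ChainComplex (ModuleCat.{v} R) ℕ}
    (f : L ⟶ L') (i : ℕ) :
    HomologicalComplex.homologyMap f (i + 1) = 0 ↔
      ∀ z : L.X (i + 1), L.d (i + 1) i z = 0 →
        ∃ w : L'.X (i + 2), L'.d (i + 2) (i + 1) w = f.f (i + 1) z :=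
  (homologyMap_eq_zero_iff_shortComplexFunctor' f (ChainComplex.prev ℕ (i + 1))
    (ChainComplex.next_nat_succ i)).trans (shortComplex_homologyMap_eq_zero_iff _)

end Homology

section Ext

lemma shortComplex_homologyMap_unopMap_eq_zero_iff {C : Type*} [Category* C] [Preadditive C]
    [CategoryWithHomology C] {S S' : ShortComplex Cᵒᵖ} (φ : S ⟶ S') :
    ShortComplex.homologyMap (ShortComplex.unopMap φ) = 0 ↔ ShortComplex.homologyMap φ = 0 := by
  rw [← Quiver.Hom.op_inj.eq_iff, ShortComplex.homologyMap_op, Limits.op_zero,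
    Preadditive.IsIso.comp_left_eq_zero, Preadditive.IsIso.comp_right_eq_zero]
  rfl

variable {C : Type u} [Category.{v} C] [Abelian C]

variable {S : ShortComplex C} (hS : S.ShortExact)

include hS in
lemma exists_comp_eq_of_comp_g_eq {A B : C} {d : A ⟶ B} {f : A ⟶ S.X₁} {k t : B ⟶ S.X₂}
    (hk : d ≫ k = f ≫ S.f) (ht : d ≫ t = 0) (h : t ≫ S.g = k ≫ S.g) :
    ∃ l : B ⟶ S.X₁, d ≫ l = f := by
  have := hS.mono_f
  refine ⟨hS.exact.lift (k - t) (by rw [Preadditive.sub_comp, h, sub_self]), ?_⟩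
  rw [← cancel_mono S.f, Category.assoc, hS.exact.lift_f, Preadditive.comp_sub, hk, ht, sub_zero]

variable {R : Type*} [Ring R] [Linear R C] [EnoughProjectives C]

lemma Ext_succ_map_app_eq_zero_iff {X Y : C} {u : X ⟶ Y} {P : ProjectiveResolution X}
    {Q : ProjectiveResolution Y} {φ : P.complex ⟶ Q.complex}
    (hφ : φ ≫ Q.π = P.π ≫ (ChainComplex.single₀ C).map u) (N : C) (n : ℕ) :
    ((Ext R C (n + 1)).map u.op).app N = 0 ↔
      ∀ f : Q.complex.X (n + 1) ⟶ N, Q.complex.d (n + 2) (n + 1) ≫ f = 0 →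
        ∃ g : P.complex.X n ⟶ N, P.complex.d (n + 1) n ≫ g = φ.f (n + 1) ≫ f := by
  -- `Ext` is the opposite of the left derived functor of `Hom(-, N) : C ⥤ (ModuleCat R)ᵒᵖ`.
  let F : C ⥤ (ModuleCat R)ᵒᵖ := ((linearYoneda R C).obj N).rightOp
  let ψ := (F.mapHomologicalComplex (ComplexShape.down ℕ)).map φ
  calc
    ((Ext R C (n + 1)).map u.op).app N = 0 ↔ (F.leftDerived (n + 1)).map u = 0 :=
      Quiver.Hom.unop_inj.eq_iff (a := (F.leftDerived (n + 1)).map u) (b := 0)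
    _ ↔ HomologicalComplex.homologyMap ψ (n + 1) = 0 := by
      rw [Functor.leftDerived_map_eq F (n + 1) u φ hφ, Preadditive.IsIso.comp_left_eq_zero,
        Preadditive.IsIso.comp_right_eq_zero]
      rfl
    _ ↔ _ := homologyMap_eq_zero_iff_shortComplexFunctor' ψ (ChainComplex.prev ℕ (n + 1))
      (ChainComplex.next_nat_succ n)
    _ ↔ _ := (shortComplex_homologyMap_unopMap_eq_zero_iff _).symm
    _ ↔ _ := shortComplex_homologyMap_eq_zero_iff _

variable [Injective S.X₂] {X Y : C} {u : X ⟶ Y}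

include hS in
lemma Ext_succ_succ_map_app_X₁_eq_zero {n : ℕ} (h : ((Ext R C (n + 1)).map u.op).app S.X₃ = 0) :
    ((Ext R C (n + 2)).map u.op).app S.X₁ = 0 := by
  have := hS.epi_g
  let P := projectiveResolution X
  let Q := projectiveResolution Y
  let φ : P.complex ⟶ Q.complex := ProjectiveResolution.lift u P Q
  have hφ := ProjectiveResolution.lift_commutes u P Q
  rw [Ext_succ_map_app_eq_zero_iff hφ] at h ⊢
  intro f hf
  obtain ⟨k, hk⟩ : ∃ k : Q.complex.X (n + 1) ⟶ S.X₂, Q.complex.d (n + 2) (n + 1) ≫ k = f ≫ S.f :=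
    ⟨_, (Q.exact_succ (n + 1)).comp_descToInjective (f ≫ S.f)
      (by simp only [reassoc_of% hf, Limits.zero_comp])⟩
  obtain ⟨g, hg⟩ := h (k ≫ S.g) (by
    rw [reassoc_of% hk, S.zero, Limits.comp_zero])
  refine exists_comp_eq_of_comp_g_eq hS (k := φ.f (n + 1) ≫ k)
    (t := P.complex.d (n + 1) n ≫ Projective.factorThru g S.g) ?_ ?_ ?_
  · rw [← φ.comm_assoc, hk, Category.assoc]
  · rw [P.complex.d_comp_d_assoc, Limits.zero_comp]
  · rw [Category.assoc, Projective.factorThru_comp, hg, Category.assoc]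

include hS in
lemma Ext_one_map_app_X₁_eq_zero
    (h : ∀ w : Y ⟶ S.X₃, ∃ w' : X ⟶ S.X₂, w' ≫ S.g = u ≫ w) :
    ((Ext R C 1).map u.op).app S.X₁ = 0 := by
  let P := projectiveResolution X
  let Q := projectiveResolution Y
  let φ : P.complex ⟶ Q.complex := ProjectiveResolution.lift u P Q
  have hφ := ProjectiveResolution.lift_commutes u P Q
  let p : P.complex.X 0 ⟶ X := P.π.f 0
  let q : Q.complex.X 0 ⟶ Y := Q.π.f 0
  have hp : P.complex.d 1 0 ≫ p = 0 := P.complex_d_comp_π_f_zero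
  have hφ₀ : φ.f 0 ≫ q = p ≫ u := (HomologicalComplex.congr_hom hφ 0).trans (by
    simp only [HomologicalComplex.comp_f, ChainComplex.single₀_map_f_zero]; rfl)
  rw [Ext_succ_map_app_eq_zero_iff hφ]
  intro f hf
  obtain ⟨k, hk⟩ : ∃ k : Q.complex.X 0 ⟶ S.X₂, Q.complex.d 1 0 ≫ k = f ≫ S.f :=
    ⟨_, (Q.exact_succ 0).comp_descToInjective (f ≫ S.f)
      (by simp only [reassoc_of% hf, Limits.zero_comp])⟩
  obtain ⟨w, hw⟩ : ∃ w : Y ⟶ S.X₃, q ≫ w = k ≫ S.g :=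
    ⟨_, Q.exact₀.g_desc (k ≫ S.g) (by simp only [reassoc_of% hk, S.zero, Limits.comp_zero])⟩
  obtain ⟨w', hw'⟩ := h w
  refine exists_comp_eq_of_comp_g_eq hS (d := P.complex.d 1 0) (k := φ.f 0 ≫ k)
    (t := p ≫ w') ?_ ?_ ?_
  · rw [← φ.comm_assoc, hk, Category.assoc]
  · rw [reassoc_of% hp, Limits.zero_comp]
  · rw [Category.assoc, hw', ← reassoc_of% hφ₀, hw, Category.assoc]

end Ext

section LocalCohomology

open Opposite

lemma isZero_pt_of_isColimit_of_forall_exists_map_eq_zero {C : Type*} [Category* C]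
    [Limits.HasZeroMorphisms C] {J : Type*} [Category* J] {F : J ⥤ C} {c : Limits.Cocone F}
    (hc : Limits.IsColimit c) (h : ∀ j, ∃ k, ∃ f : j ⟶ k, F.map f = 0) : Limits.IsZero c.pt := by
  refine (Limits.IsZero.iff_id_eq_zero _).2 (hc.hom_ext fun j => ?_)
  obtain ⟨k, f, hf⟩ := h j
  rw [← c.w f, hf, Limits.zero_comp, Limits.zero_comp, Limits.zero_comp]

variable {R : Type u} [CommRing R]

lemma isZero_localCohomology_of_forall_exists_Ext_map_factor_app_eq_zero (I : Ideal R) (i : ℕ)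
    (N : ModuleCat.{u} R)
    (hN : ∀ n, ∃ m, ∃ h : n ≤ m, ((Ext R (ModuleCat R) i).map
      (ModuleCat.ofHom (Submodule.factor (Ideal.pow_le_pow_right (I := I) h))).op).app N = 0) :
    Limits.IsZero ((localCohomology I i).obj N) := by
  let D := localCohomology.diagram (localCohomology.idealPowersDiagram I) i
  have : Limits.HasColimit D := localCohomology.hasColimitDiagram _ _
  refine isZero_pt_of_isColimit_of_forall_exists_map_eq_zero (Limits.isColimitOfPreserves
    ((evaluation _ _).obj N) (Limits.colimit.isColimit D)) fun j => ?_
  obtain ⟨m, h, vanish⟩ := hN (unop (unop j))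
  exact ⟨op (op m), (homOfLE h).op.op, vanish⟩

end LocalCohomology

section InjectiveModules

variable {R : Type u} [CommRing R]

instance injective_linearMap_of_flat (F : Type*) [AddCommGroup F] [Module R F] [Module.Flat R F]
    (E : Type w) [Small.{w} R] [AddCommGroup E] [Module R E] [Module.Injective R E] :
    Module.Injective R (F →ₗ[R] E) where
  -- `Hom(-, Hom(F, E)) = Hom(- ⊗ F, E)` is a composite of two exact functors.
  out X Y _ _ _ _ f hf g := by
    obtain ⟨h, hh⟩ := Module.Injective.extension_property R E _ _ (f.rTensor F)
      (Module.Flat.rTensor_preserves_injective_linearMap f hf) (TensorProduct.lift g)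
    exact ⟨TensorProduct.curry h, fun x =>
      LinearMap.ext fun y => LinearMap.congr_fun hh (x ⊗ₜ[R] y)⟩

/-- The sequence `0 → Hom(S.X₃, E) → Hom(S.X₂, E) → Hom(S.X₁, E) → 0` obtained by applying
`Hom(-, E)` to a short complex `S` of modules. -/
abbrev homShortComplex (S : ShortComplex (ModuleCat.{v} R)) (E : Type w) [AddCommGroup E]
    [Module R E] : ShortComplex (ModuleCat.{max v w} R) where
  X₁ := ModuleCat.of R (S.X₃ →ₗ[R] E)
  X₂ := ModuleCat.of R (S.X₂ →ₗ[R] E)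
  X₃ := ModuleCat.of R (S.X₁ →ₗ[R] E)
  f := ModuleCat.ofHom (LinearMap.lcomp R E S.g.hom)
  g := ModuleCat.ofHom (LinearMap.lcomp R E S.f.hom)
  zero := by
    ext h : 2
    change h ∘ₗ (S.f ≫ S.g).hom = 0
    rw [S.zero, ModuleCat.hom_zero, LinearMap.comp_zero]

lemma shortExact_homShortComplex {S : ShortComplex (ModuleCat.{v} R)} (hS : S.ShortExact)
    (E : Type w) [Small.{w} R] [AddCommGroup E] [Module R E] [Module.Injective R E] :
    (homShortComplex S E).ShortExact := by
  have f_injective := (ModuleCat.mono_iff_injective S.f).1 hS.mono_f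
  have g_surjective := (ModuleCat.epi_iff_surjective S.g).1 hS.epi_g
  have exact := (ShortComplex.ShortExact.moduleCat_exact_iff_function_exact S).1 hS.exact
  exact ModuleCat.shortComplex_shortExact _
    (LinearMap.exact_lcomp_of_exact_of_surjective E exact g_surjective)
    (LinearMap.lcomp_injective_of_surjective S.g.hom g_surjective)
    (Module.Injective.extension_property R E _ _ S.f.hom f_injective)

variable {F : Type*} [AddCommGroup F] [Module R F]

lemma exists_comap_pow_smul_top_le [IsNoetherianRing R] [Module.Finite R F] (K : Submodule R F)
    (I : Ideal R) (n : ℕ) :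
    ∃ c, (I ^ (n + c) • ⊤ : Submodule R F).comap K.subtype ≤ I ^ n • ⊤ := by
  obtain ⟨c, hc⟩ := I.exists_pow_inf_eq_pow_smul K
  refine ⟨c, ?_⟩
  rw [← Submodule.map_le_map_iff_of_injective K.injective_subtype, Submodule.map_comap_subtype,
    Submodule.map_smul'', Submodule.map_top, Submodule.range_subtype, inf_comm,
    hc (n + c) (Nat.le_add_left c n), Nat.add_sub_cancel]
  exact Submodule.smul_mono le_rfl inf_le_right

variable {K : Submodule R F} {E : Type w} [Small.{w} R] [AddCommGroup E] [Module R E]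
  [Module.Injective R E]

lemma exists_comp_subtype_eq_of_comap_le_ker {T : Submodule R F} {ψ : K →ₗ[R] E}
    (h : T.comap K.subtype ≤ LinearMap.ker ψ) :
    ∃ Ψ : F →ₗ[R] E, T ≤ LinearMap.ker Ψ ∧ Ψ ∘ₗ K.subtype = ψ := by
  have mapQ_injective : Function.Injective (Submodule.mapQ _ T K.subtype le_rfl) := by
    rw [← LinearMap.ker_eq_bot, Submodule.mapQ, Submodule.ker_liftQ, LinearMap.ker_comp,
      Submodule.ker_mkQ]
    exact Submodule.mkQ_map_self _
  obtain ⟨g, hg⟩ := Module.Injective.extension_property R E _ _ _ mapQ_injective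
    ((T.comap K.subtype).liftQ ψ h)
  refine ⟨g ∘ₗ T.mkQ, T.ker_mkQ.ge.trans (LinearMap.ker_le_ker_comp _ _), ?_⟩
  rw [LinearMap.comp_assoc, ← Submodule.mapQ_mkQ _ _ _ (h := le_rfl), ← LinearMap.comp_assoc, hg,
    Submodule.liftQ_mkQ]

lemma torsionBySet_le_map_lcomp_subtype_of_comap_le {I J : Ideal R}
    (h : (J • ⊤ : Submodule R F).comap K.subtype ≤ I • ⊤) :
    Submodule.torsionBySet R (K →ₗ[R] E) I ≤
      (Submodule.torsionBySet R (F →ₗ[R] E) J).map (LinearMap.lcomp R E K.subtype) := by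
  intro ψ hψ
  have hker : I • ⊤ ≤ LinearMap.ker ψ := Submodule.smul_le.2 fun r hr x _ => by
    rw [LinearMap.mem_ker, map_smul]
    exact LinearMap.congr_fun ((Submodule.mem_torsionBySet_iff _ _).1 hψ ⟨r, hr⟩) x
  obtain ⟨Ψ, hΨ, hΨψ⟩ := exists_comp_subtype_eq_of_comap_le_ker (h.trans hker)
  refine ⟨Ψ, (Submodule.mem_torsionBySet_iff _ _).2 fun r => LinearMap.ext fun x => ?_, hΨψ⟩
  exact (map_smul Ψ _ x).symm.trans (hΨ (Submodule.smul_mem_smul r.2 trivial))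

end InjectiveModules

section ExtVanishing

variable {R : Type u} [CommRing R]

lemma Ext_one_map_factor_app_X₁_eq_zero {S : ShortComplex (ModuleCat.{u} R)} (hS : S.ShortExact)
    [Injective S.X₂] {I J : Ideal R} (hJI : J ≤ I)
    (h : Submodule.torsionBySet R S.X₃ I ≤ (Submodule.torsionBySet R S.X₂ J).map S.g.hom) :
    ((Ext R (ModuleCat R) 1).map (ModuleCat.ofHom (Submodule.factor hJI)).op).app S.X₁ = 0 := by
  refine Ext_one_map_app_X₁_eq_zero hS fun w => ?_
  have hw : w.hom (I.mkQ 1) ∈ Submodule.torsionBySet R S.X₃ I := by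
    refine (Submodule.mem_torsionBySet_iff _ _).2 fun r => ?_
    have : (r : R) • I.mkQ 1 = 0 := by
      rw [← map_smul, smul_eq_mul, mul_one]
      exact (Submodule.Quotient.mk_eq_zero _).2 r.2
    rw [← map_smul, this, map_zero]
  obtain ⟨y, hy, hyw⟩ := h hw
  have hJ : J ≤ LinearMap.ker (LinearMap.toSpanSingleton R _ y) := fun r hr =>
    (Submodule.mem_torsionBySet_iff _ _).1 hy ⟨r, hr⟩
  refine ⟨ModuleCat.ofHom (J.liftQ (LinearMap.toSpanSingleton R _ y) hJ), ModuleCat.hom_ext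
    (Submodule.linearMap_qext _ (LinearMap.ext_ring ?_))⟩
  change S.g.hom ((1 : R) • y) = w.hom (I.mkQ 1)
  rw [one_smul, hyw]

variable [IsNoetherianRing R]

lemma exists_Ext_succ_map_factor_app_linearMap_eq_zero (I : Ideal R) (i n : ℕ) (M : Type u)
    [AddCommGroup M] [Module R M] [Module.Finite R M] :
    ∃ m, ∃ h : n ≤ m, ∀ (E : Type u) [AddCommGroup E] [Module R E] [Module.Injective R E],
      ((Ext R (ModuleCat R) (i + 1)).map (ModuleCat.ofHom
        (Submodule.factor (Ideal.pow_le_pow_right (I := I) h))).op).app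
          (ModuleCat.of R (M →ₗ[R] E)) = 0 := by
  induction i generalizing M with
  | zero =>
    obtain ⟨r, p, hp⟩ := Module.Finite.exists_fin' R M
    obtain ⟨c, hc⟩ := exists_comap_pow_smul_top_le (LinearMap.ker p) I n
    refine ⟨n + c, Nat.le_add_right n c, fun E _ _ _ => ?_⟩
    have := Module.injective_object_of_injective_module R ((Fin r → R) →ₗ[R] E)
    exact Ext_one_map_factor_app_X₁_eq_zero
      (shortExact_homShortComplex (LinearMap.shortExact_shortComplexKer hp) E) _
      (torsionBySet_le_map_lcomp_subtype_of_comap_le hc)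
  | succ i ih =>
    obtain ⟨r, p, hp⟩ := Module.Finite.exists_fin' R M
    obtain ⟨m, h, vanish⟩ := ih (LinearMap.ker p)
    refine ⟨m, h, fun E _ _ _ => ?_⟩
    have := Module.injective_object_of_injective_module R ((Fin r → R) →ₗ[R] E)
    exact Ext_succ_succ_map_app_X₁_eq_zero
      (shortExact_homShortComplex (LinearMap.shortExact_shortComplexKer hp) E) (vanish E)

theorem isZero_localCohomology_linearMap_of_injective (I : Ideal R) (i : ℕ) (M : Type u)
    [AddCommGroup M] [Module R M] [Module.Finite R M] (E : Type u) [AddCommGroup E] [Module R E]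
    [Module.Injective R E] :
    Limits.IsZero ((localCohomology I (i + 1)).obj (ModuleCat.of R (M →ₗ[R] E))) :=
  isZero_localCohomology_of_forall_exists_Ext_map_factor_app_eq_zero I (i + 1) _ fun n =>
    let ⟨m, h, vanish⟩ := exists_Ext_succ_map_factor_app_linearMap_eq_zero I i n M
    ⟨m, h, vanish E⟩

end ExtVanishing

namespace Koszul

variable {R : Type u} [CommRing R]

lemma tensor_d_succ_apply (x : R) (L : ChainComplex (ModuleCat.{v} R) ℕ) (n : ℕ)
    (a : L.X (n + 2)) (b : L.X (n + 1)) :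
    (tensor x L).d (n + 2) (n + 1) (a, b) =
      (L.d (n + 2) (n + 1) a + x • b, -L.d (n + 1) n b) := by
  rw [tensor_d]
  rfl

lemma tensor_d_one_zero_apply (x : R) (L : ChainComplex (ModuleCat.{v} R) ℕ)
    (a : L.X 1) (b : L.X 0) : (tensor x L).d 1 0 (a, b) = L.d 1 0 a + x • b := by
  rw [tensor_d]
  rfl

lemma tensorMap_f_succ_apply {x x' y : R} (h : x = x' * y)
    {L L' : ChainComplex (ModuleCat.{v} R) ℕ} (f : L ⟶ L') (n : ℕ) (a : L.X (n + 1)) (b : L.X n) :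
    (tensorMap h f).f (n + 1) (a, b) = (f.f (n + 1) a, y • f.f n b) :=
  rfl

lemma tensorMap_comp {x₁ x₂ x₃ y z w : R} (h₁ : x₁ = x₂ * y) (h₂ : x₂ = x₃ * z) (h : x₁ = x₃ * w)
    (hw : w = z * y) {L₁ L₂ L₃ : ChainComplex (ModuleCat.{v} R) ℕ} (f : L₁ ⟶ L₂) (g : L₂ ⟶ L₃) :
    tensorMap h₁ f ≫ tensorMap h₂ g = tensorMap h (f ≫ g) := by
  subst hw
  ext n : 1
  cases n with
  | zero => rfl
  | succ n =>
    ext ⟨a, b⟩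
    change (g.f (n + 1) (f.f (n + 1) a), z • g.f n (y • f.f n b)) =
      (g.f (n + 1) (f.f (n + 1) a), (z * y) • g.f n (f.f n b))
    rw [map_smul, smul_smul]

lemma transition_comp (M : ModuleCat.{v} R) {k n m : ℕ} (h : k ≤ n) (h' : n ≤ m) (xs : List R) :
    transition M h' xs ≫ transition M h xs = transition M (h.trans h') xs := by
  induction xs with
  | nil => exact Category.comp_id _
  | cons x xs ih =>
    rw [transition, transition, transition, ← ih]
    apply tensorMap_comp
    rw [← pow_add]
    congr 1
    omega

instance isNoetherian_complex_X_zero (M : ModuleCat.{v} R) [IsNoetherian R M] (xs : List R) :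
    IsNoetherian R ((complex M xs).X 0) := by
  induction xs with
  | nil => exact ‹IsNoetherian R M›
  | cons _ _ ih => exact ih

variable {L₁ L₂ L₃ : ChainComplex (ModuleCat.{v} R) ℕ}

lemma d_add_smul_eq_zero_of_tensor_d_eq_zero {x : R} {i : ℕ} {a : L₁.X (i + 1)} {b : L₁.X i}
    (h : (tensor x L₁).d (i + 1) i (a, b) = 0) : L₁.d (i + 1) i a + x • b = 0 := by
  cases i with
  | zero => rwa [tensor_d_one_zero_apply] at h
  | succ i =>
    rw [tensor_d_succ_apply] at h
    exact congrArg Prod.fst h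

lemma exists_tensor_d_eq_tensorMap_apply_d {x x' z : R} (h : x = x' * z) {g : L₂ ⟶ L₃} {i : ℕ}
    (hg : HomologicalComplex.homologyMap g (i + 1) = 0) {a c : L₂.X (i + 1)}
    (hac : L₂.d (i + 1) i a + x • L₂.d (i + 1) i c = 0) :
    ∃ w : (tensor x' L₃).X (i + 2), (tensor x' L₃).d (i + 2) (i + 1) w =
      (tensorMap h g).f (i + 1) (a, L₂.d (i + 1) i c) := by
  -- Up to the boundary of `(0, -c)`, the cycle `(a, d c)` is `(a + x c, 0)`.
  obtain ⟨e, he⟩ := (chainComplex_homologyMap_succ_eq_zero_iff g i).1 hg (a + x • c) (by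
    rw [map_add, map_smul, hac])
  refine ⟨(e, -(z • g.f (i + 1) c)), ?_⟩
  rw [tensor_d_succ_apply, tensorMap_f_succ_apply, he, ← comm_apply, map_neg, map_smul, neg_neg,
    map_add, map_smul, h, mul_smul, smul_neg, add_neg_cancel_right]

-- A cycle `(a, b)` of `K(x₁) ⊗ L₁` has `b` a cycle up to sign, except in degree `1`, where `b` only
-- satisfies `x₁ b ∈ im d`; `hf₀` then does what `hf` does in the higher degrees.
theorem homologyMap_tensorMap_comp_eq_zero {x₁ x₂ x₃ y z : R} (h₁ : x₁ = x₂ * y)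
    (h₂ : x₂ = x₃ * z) {f : L₁ ⟶ L₂} {g : L₂ ⟶ L₃}
    (hf : ∀ i, HomologicalComplex.homologyMap f (i + 1) = 0)
    (hg : ∀ i, HomologicalComplex.homologyMap g (i + 1) = 0)
    (hf₀ : ∀ b : L₁.X 0, x₁ • b ∈ LinearMap.range (L₁.d 1 0).hom →
      y • f.f 0 b ∈ LinearMap.range (L₂.d 1 0).hom) (i : ℕ) :
    HomologicalComplex.homologyMap (tensorMap h₁ f ≫ tensorMap h₂ g) (i + 1) = 0 := by
  rw [chainComplex_homologyMap_succ_eq_zero_iff]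
  rintro ⟨a, b⟩ hz
  have hab := d_add_smul_eq_zero_of_tensor_d_eq_zero hz
  obtain ⟨c, hc⟩ : ∃ c, L₂.d (i + 1) i c = y • f.f i b := by
    cases i with
    | zero => exact hf₀ b ⟨-a, by rw [map_neg, neg_eq_of_add_eq_zero_right hab]⟩
    | succ i =>
      rw [tensor_d_succ_apply] at hz
      obtain ⟨c, hc⟩ := (chainComplex_homologyMap_succ_eq_zero_iff f i).1 (hf i) b
        (neg_eq_zero.1 (congrArg Prod.snd hz))
      exact ⟨y • c, by rw [map_smul, hc]⟩
  have hac : L₂.d (i + 1) i (f.f (i + 1) a) + x₂ • L₂.d (i + 1) i c = 0 := by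
    rw [hc, comm_apply, smul_smul, ← h₁, ← map_smul, ← map_add, hab, map_zero]
  obtain ⟨w, hw⟩ := exists_tensor_d_eq_tensorMap_apply_d h₂ (hg i) hac
  exact ⟨w, by rw [hw, hc]; rfl⟩

end Koszul

open Filter in
lemma eventually_pow_smul_mem {R : Type*} [CommRing R] {Q : Type*} [AddCommGroup Q] [Module R Q]
    [IsNoetherian R Q] (B : Submodule R Q) (x : R) :
    ∀ᶠ c in atTop, ∀ (k : ℕ) (b : Q), x ^ k • b ∈ B → x ^ c • b ∈ B := by
  have mem_iff (k : ℕ) (b : Q) :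
      x ^ k • b ∈ B ↔ B.mkQ b ∈ LinearMap.ker (algebraMap R (Module.End R (Q ⧸ B)) x ^ k) := by
    rw [← map_pow, LinearMap.mem_ker, Module.algebraMap_end_apply, ← map_smul, Submodule.mkQ_apply,
      Submodule.Quotient.mk_eq_zero]
  filter_upwards [(algebraMap R (Module.End R (Q ⧸ B)) x).eventually_iSup_ker_pow_eq]
    with c hc k b hb
  rw [mem_iff] at hb ⊢
  rw [← hc]
  exact Submodule.mem_iSup_of_mem k hb

namespace Koszul

variable {R : Type u} [CommRing R] (M : ModuleCat.{v} R)

lemma homologyMap_transition_nil_succ (n i : ℕ) :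
    HomologicalComplex.homologyMap (transition M (le_refl n) []) (i + 1) = 0 :=
  (HomologicalComplex.isZero_single_obj_homology _ 0 M (i + 1) (Nat.succ_ne_zero i)).eq_of_src _ _

lemma homologyMap_transition_eq_zero_of_le {n m m' i : ℕ} {h : n ≤ m} {xs : List R}
    (hm : HomologicalComplex.homologyMap (transition M h xs) i = 0) (h' : m ≤ m') :
    HomologicalComplex.homologyMap (transition M (h.trans h') xs) i = 0 := by
  rw [← transition_comp M h h', HomologicalComplex.homologyMap_comp, hm, Limits.comp_zero]

theorem exists_homologyMap_transition_eq_zero [IsNoetherian R M] (xs : List R) (n : ℕ) :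
    ∃ m, ∃ h : n ≤ m, ∀ i, HomologicalComplex.homologyMap (transition M h xs) (i + 1) = 0 := by
  induction xs generalizing n with
  | nil => exact ⟨n, le_rfl, homologyMap_transition_nil_succ M n⟩
  | cons x xs ih =>
    obtain ⟨m₁, h₁, H₁⟩ := ih n
    obtain ⟨m₂, h₂, H₂⟩ := ih m₁
    let B := LinearMap.range ((complex M (xs.map (· ^ m₁))).d 1 0).hom
    obtain ⟨m, hc, hm⟩ := (((Filter.tendsto_sub_atTop_nat m₁).eventually
      (eventually_pow_smul_mem B x)).and (Filter.eventually_ge_atTop m₂)).exists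
    refine ⟨m, h₁.trans (h₂.trans hm), fun i => ?_⟩
    rw [← transition_comp M h₁ (h₂.trans hm)]
    refine homologyMap_tensorMap_comp_eq_zero _ _
      (fun i => homologyMap_transition_eq_zero_of_le M (H₂ i) hm) H₁ (fun b hb => hc m _ ?_) i
    obtain ⟨a, ha⟩ := hb
    exact ⟨(transition M (h₂.trans hm) xs).f 1 a, by rw [comm_apply, ha, map_smul]⟩

end Koszul

theorem isWeaklyProregular_of_isNoetherian {R : Type u} [CommRing R] (xs : List R)
    (M : Type v) [AddCommGroup M] [Module R M] [IsNoetherian R M] : IsWeaklyProregular xs M := by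
  intro n
  obtain ⟨m, h, vanish⟩ := Koszul.exists_homologyMap_transition_eq_zero (ModuleCat.of R M) xs n
  refine ⟨m, h, fun i hi => ?_⟩
  obtain ⟨i, rfl⟩ := Nat.exists_eq_add_of_le' hi
  exact vanish i

theorem mainTheorem5 (R : Type u) [CommRing R] [IsNoetherianRing R]
    (M : Type u) [AddCommGroup M] [Module R M] [Module.Finite R M] :
    (∀ (I : Ideal R) (E : Type u) [AddCommGroup E] [Module R E], Module.Injective R E →
      ∀ i : ℕ, i ≠ 0 →
        Limits.IsZero ((localCohomology I i).obj (ModuleCat.of R (M →ₗ[R] E)))) ∧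
    (∀ xs : List R, IsWeaklyProregular xs M) := by
  refine ⟨fun I E _ _ _ i hi => ?_, fun xs => isWeaklyProregular_of_isNoetherian xs M⟩
  obtain ⟨i, rfl⟩ := Nat.exists_eq_succ_of_ne_zero hi
  exact isZero_localCohomology_linearMap_of_injective I i M E
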